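/- Throughout, $n\ge 1$ is the number of rows of a dataset, $d=d(n)$ is an arbitrary function of $n$, and $X=X_n=\{0,1\}^{d(n)}$. A mechanism $M$ is a randomized map that sends a dataset $\mathbf x=(x_1,\dots,x_n)\in X^n$ to a random element of an output space $T=T_n$ (for each $n$). For real functions $\varepsilon,\delta\ge 0$ of $n$, $M$ is $(\varepsilon,\delta)$-differentially private if for every $n$, all $\mathbf x,\mathbf x'\in X^n$ that differ in exactly one row and every (measurable) event $S\subseteq T$, $\Pr[M(\mathbf x)\in S]\le e^{\varepsilon(n)}\Pr[M(\mathbf x')\in S]+\delta(n)$. For a probability distribution $D$ on $X$ and a predicate $p:X\to\{0,1\}$ put $\mathrm{weight}_D(p)=\mathbb E_{x\sim D}[p(x)]$. The predicate $p$ isolates a row of $\mathbf x$ if $p(x_i)=1$ for exactly one index $i$. An adversary $A$ is a randomized map from $T$ to predicates on $X$ (computationally unbounded, and it may depend on $D$ and $n$). For a set $P$ of predicates let $$\mathsf{Succ}^{A,M}_{P}(n)=\Pr_{\mathbf x\sim D^n,\ p\leftarrow A(M(\mathbf x))}\bigl[p\text{ isolates a row of }\mathbf x\ \text{ and }\ p\in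 P\bigr],$$ and let the baseline $\mathsf{base}(n,P)$ be the supremum of this probability over all trivial adversaries, i.e. over all randomized choices of $p$ independent of $\mathbf x$. The subscripts $\le w$ and $\ge w$ stand for $P=\{p:\mathrm{weight}_D(p)\le w\}$ and $P=\{p:\mathrm{weight}_D(p)\ge w\}$. For real functions $\varepsilon,\delta,w_{\mathsf{low}},w_{\mathsf{high}}$ of $n$, $M$ is $(\varepsilon,\delta,w_{\mathsf{low}},w_{\mathsf{high}})$-PSO secure (secure against predicate singling out) if for all $n\ge1$, all distributions $D$ on $X_n$ and all adversaries $A$, $$\mathsf{Succ}^{A,M}_{\le w_{\mathsf{low}}(n)}(n)\le e^{\varepsilon(n)}\,\mathsf{base}(n,\le w_{\mathsf{low}}(n))+\delta(n)\quad\text{and}\quad \mathsf{Succ}^{A,M}_{\ge w_{\mathsf{high}}(n)}(n)\le e^{\varepsilon(n)}\,\mathsf{base}(n,\ge w_{\mathsf{high}}(n))+\delta(n).$$ A function $f$ is negligible if $n^c f(n)\to 0$ as $n\to\infty$ for every $c\in\mathbb N$. **Theorem.** Let $\varepsilon,\delta\ge0$ and $w_{\mathsf{low}},w_{\mathsf{high}}$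 be real functions of $n\ge 1$ such that $\varepsilon=O(1)$, $\delta$ is negligible, $w_{\mathsf{low}}(n)\le 1/n$ for all $n$, and $w_{\mathsf{high}}(n)=\omega(\log n/n)$, i.e. $w_{\mathsf{high}}(n)\big/\tfrac{\log n}{n}\to+\infty$. If $M$ is $(\varepsilon,\delta)$-differentially private, then there is a negligible function $\delta'\ge0$ such that $M$ is $(\varepsilon',\delta',w_{\mathsf{low}},w_{\mathsf{high}})$-PSO secure with $$\varepsilon'(n)=\varepsilon(n)+(n-1)\ln\!\left(\frac{1}{1-w_{\mathsf{low}}(n)}\right)$$ (for $n=1$ this means $\varepsilon'(1)=\varepsilon(1)$). -/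

import Mathlib

open MeasureTheory ProbabilityTheory Filter Topology

noncomputable section

namespace PSO

/-- The data universe `{0,1}^d`, with its discrete measurable structure. -/
abbrev Row (d : ℕ) : Type := Fin d → Bool

/-- Datasets with `n` rows. -/
abbrev Dataset (n d : ℕ) : Type := Fin n → Row d

/-- Predicates `{0,1}^d → {0,1}`. -/
abbrev Pred (d : ℕ) : Type := Row d → Bool

/-- The weight of `p` under `D`: the expectation of `p x` for `x ∼ D`, that is, the probability
that `p` matches a random row. -/
def weight {d : ℕ} (D : Measure (Row d)) (p : Pred d) : ℝ :=
  D.real {x | p x = true}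

/-- `p` isolates a row of `x`: it is true on exactly one row. -/
def Isolates {n d : ℕ} (p : Pred d) (x : Dataset n d) : Prop :=
  ∃! i : Fin n, p (x i) = true

/-- The success probability of the adversary `A` against the mechanism `M`, with predicates
restricted to `P`: the probability, over `x ∼ D^n` and `p ∼ A (M x)`, that `p` isolates a row of
`x` and belongs to `P`. -/
def succProb {n d : ℕ} {T : Type*} [MeasurableSpace T] (D : Measure (Row d))
    (M : Kernel (Dataset n d) T) (A : Kernel T (Pred d)) (P : Set (Pred d)) : ℝ :=
  ((Measure.pi fun _ : Fin n => D) ⊗ₘ (A ∘ₖ M)).real {xp | Isolates xp.2 xp.1 ∧ xp.2 ∈ P}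

/-- The mechanism that releases nothing. -/
def trivialMech (n d : ℕ) : Kernel (Dataset n d) Unit :=
  Kernel.const _ (Measure.dirac ())

/-- The baseline for predicates in `P` : the supremum of the success probabilities of the (possibly
randomized) trivial adversaries, which see nothing of the data. -/
def base {d : ℕ} (n : ℕ) (D : Measure (Row d)) (P : Set (Pred d)) : ℝ :=
  ⨆ A : {A : Kernel Unit (Pred d) // IsMarkovKernel A}, succProb D (trivialMech n d) A.1 P

/-- Predicates of weight at most `w`. -/
def lowWeight {d : ℕ} (D : Measure (Row d)) (w : ℝ) : Set (Pred d) :=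
  {p | weight D p ≤ w}

/-- Predicates of weight at least `w`. -/
def highWeight {d : ℕ} (D : Measure (Row d)) (w : ℝ) : Set (Pred d) :=
  {p | w ≤ weight D p}

/-- Two datasets are neighbours if they differ in exactly one row. -/
def Neighbors {n d : ℕ} (x x' : Dataset n d) : Prop :=
  ∃! i : Fin n, x i ≠ x' i

/-- `(ε, δ)`-differential privacy. -/
def DiffPrivate {n d : ℕ} {T : Type*} [MeasurableSpace T] (ε δ : ℝ)
    (M : Kernel (Dataset n d) T) : Prop :=
  ∀ x x' : Dataset n d, Neighbors x x' → ∀ S : Set T, MeasurableSet S →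
    (M x).real S ≤ Real.exp ε * (M x').real S + δ

/-- `(ε, δ, wlow, whigh)`-security against predicate singling out, for a mechanism given for every
number `n` of rows, over the universe `{0,1}^(d n)`: no (randomized, computationally unbounded)
adversary, whatever the distribution `D` of the rows, beats the baseline by more than the factor
`exp ε` and the additive term `δ`, for predicates of weight at most `wlow` and for predicates of
weight at least `whigh`. -/
def PSOSecure {d : ℕ → ℕ} {T : ℕ → Type*} [∀ n, MeasurableSpace (T n)]
    (ε δ wlow whigh : ℕ → ℝ) (M : ∀ n, Kernel (Dataset n (d n)) (T n)) : Prop :=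
  ∀ n : ℕ, 1 ≤ n → ∀ D : Measure (Row (d n)), IsProbabilityMeasure D →
    ∀ A : Kernel (T n) (Pred (d n)), IsMarkovKernel A →
      succProb D (M n) A (lowWeight D (wlow n)) ≤
          Real.exp (ε n) * base n D (lowWeight D (wlow n)) + δ n ∧
        succProb D (M n) A (highWeight D (whigh n)) ≤
          Real.exp (ε n) * base n D (highWeight D (whigh n)) + δ n

/-- Negligible functions: `f n` tends to `0` faster than every inverse power of `n`. -/
def Negligible (f : ℕ → ℝ) : Prop :=
  Asymptotics.SuperpolynomialDecay atTop (fun n : ℕ => (n : ℝ)) f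

end PSO

end

/-! By post-processing, the composite Q = A ∘ M from dataset to predicate is itself private. All of
privacy is used through one exchange (`DiffPrivate.sum_swap_le`): swapping row i with a fresh
independent sample y preserves the joint law of (x, y), so making p depend on y instead of x i costs
e^ε and δ.

Low weights: isolating p must match some row. After the exchange p is independent of the row it is
tested on, so each row is matched with probability at most e^ε w + δ. The union bound gives n(e^ε w
+ δ). With w the largest weight allowed, a fixed predicate of that weight already isolates with
probability n w (1 - w)^(n-1), so the loss against the baseline is (1 - w)^(-(n-1)).

High weights: let a_k be the probability that p is admissible and matches exactly k rows. Exchanging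
an unmatched row for a fresh one, which p matches with probability at least w, yields w(n - k) a_k ≤
e^ε (k + 1) a_(k+1) + nδ (`DiffPrivate.matchProb_le_succ`). So a_k at least doubles, up to an
additive error, while k is below a constant times wn. As no a_k exceeds 1, a_1 is exponentially
small in wn, hence negligible when wn = ω(log n). The baseline is not needed here. -/

namespace PSO

/-! ### Privacy under post-processing -/

/-- A pure threshold inequality between two measures extends to `[0, 1]`-valued functions. -/
lemma integral_le_of_real_le {T : Type*} [MeasurableSpace T] {μ ν : Measure T}
    [IsProbabilityMeasure μ] [IsProbabilityMeasure ν] {c δ : ℝ}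
    (h : ∀ S, MeasurableSet S → μ.real S ≤ c * ν.real S + δ) {f : T → ℝ} (hf : Measurable f)
    (hf0 : ∀ t, 0 ≤ f t) (hf1 : ∀ t, f t ≤ 1) :
    ∫ t, f t ∂μ ≤ c * ∫ t, f t ∂ν + δ := by
  have hint : ∀ (ρ : Measure T) [IsProbabilityMeasure ρ], Integrable f ρ := fun ρ _ =>
    Integrable.of_bound hf.aestronglyMeasurable 1
      (ae_of_all _ fun t => by rw [Real.norm_of_nonneg (hf0 t)]; exact hf1 t)
  -- Layer cake: the hypothesis applies to each superlevel set, and δ is paid only once because the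
  -- thresholds fill an interval of length 1.
  have hlayer : ∀ (ρ : Measure T) [IsProbabilityMeasure ρ],
      ∫ t, f t ∂ρ = ∫ s in Set.Ioc (0 : ℝ) 1, ρ.real {t | s ≤ f t} := fun ρ _ =>
    (hint ρ).integral_eq_integral_Ioc_meas_le (ae_of_all _ hf0) (ae_of_all _ hf1)
  have hI : ∀ (ρ : Measure T) [IsProbabilityMeasure ρ],
      Integrable (fun s => ρ.real {t | s ≤ f t}) (volume.restrict (Set.Ioc (0 : ℝ) 1)) := by
    intro ρ _
    refine Integrable.of_bound (C := 1) ?_ (ae_of_all _ fun s => ?_)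
    · refine (Antitone.measurable ?_).aestronglyMeasurable
      intro a b hab
      exact measureReal_mono fun t ht => le_trans hab ht
    · rw [Real.norm_of_nonneg measureReal_nonneg]
      exact measureReal_le_one
  rw [hlayer μ, hlayer ν]
  calc ∫ s in Set.Ioc (0 : ℝ) 1, μ.real {t | s ≤ f t}
      ≤ ∫ s in Set.Ioc (0 : ℝ) 1, (c * ν.real {t | s ≤ f t} + δ) :=
        integral_mono (hI μ) (((hI ν).const_mul c).add (integrable_const δ))
          fun s => h _ (measurableSet_le measurable_const hf)
    _ = c * (∫ s in Set.Ioc (0 : ℝ) 1, ν.real {t | s ≤ f t}) + δ := by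
        rw [integral_add ((hI ν).const_mul c) (integrable_const δ), integral_const_mul]
        simp

/-- Differential privacy is preserved by post-processing. -/
lemma DiffPrivate.comp {n d : ℕ} {T U : Type*} [MeasurableSpace T] [MeasurableSpace U]
    {ε δ : ℝ} {M : Kernel (Dataset n d) T} [IsMarkovKernel M] (hM : DiffPrivate ε δ M)
    (A : Kernel T U) [IsMarkovKernel A] : DiffPrivate ε δ (A ∘ₖ M) := by
  intro x x' hx S hS
  have key : ∀ z, ((A ∘ₖ M) z).real S = ∫ t, (A t).real S ∂(M z) := by
    intro z
    rw [measureReal_def, Kernel.comp_apply' _ _ _ hS, integral_eq_lintegral_of_nonneg_ae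
      (ae_of_all _ fun t => measureReal_nonneg)
      (A.measurable_coe hS).ennreal_toReal.aestronglyMeasurable]
    simp [measureReal_def]
  rw [key, key]
  exact integral_le_of_real_le (hM x x' hx) (A.measurable_coe hS).ennreal_toReal
    (fun t => measureReal_nonneg) fun t => measureReal_le_one

/-! ### Product weights and the row exchange -/

/-- The probability of a dataset under i.i.d. sampling. -/
def dataWeight {n d : ℕ} (D : Measure (Row d)) (x : Dataset n d) : ℝ :=
  ∏ i, D.real {x i}

/-- The number of rows of `x` that satisfy `p`. -/
def matchCount {n d : ℕ} (p : Pred d) (x : Dataset n d) : ℕ :=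
  (Finset.univ.filter fun i => p (x i) = true).card

lemma isolates_iff_matchCount {n d : ℕ} (p : Pred d) (x : Dataset n d) :
    Isolates p x ↔ matchCount p x = 1 := by
  rw [matchCount, Finset.card_eq_one, Isolates]
  constructor
  · rintro ⟨i, hi, h⟩
    exact ⟨i, by ext j; simp only [Finset.mem_filter, Finset.mem_univ, true_and,
      Finset.mem_singleton]; exact ⟨h j, fun e => e ▸ hi⟩⟩
  · rintro ⟨i, h⟩
    have h' : ∀ j, p (x j) = true ↔ j = i := fun j => by
      have := congrArg (j ∈ ·) h
      simpa using this
    exact ⟨i, (h' i).2 rfl, fun j hj => (h' j).1 hj⟩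

lemma dataWeight_nonneg {n d : ℕ} (D : Measure (Row d)) (x : Dataset n d) :
    0 ≤ dataWeight D x :=
  Finset.prod_nonneg fun _ _ => measureReal_nonneg

lemma real_pi_singleton {n d : ℕ} (D : Measure (Row d)) [IsProbabilityMeasure D]
    (x : Dataset n d) : (Measure.pi fun _ : Fin n => D).real {x} = dataWeight D x := by
  rw [measureReal_def, Measure.pi_singleton, ENNReal.toReal_prod]
  rfl

lemma sum_real_singleton_eq_one {α : Type*} [Fintype α] [MeasurableSpace α]
    [MeasurableSingletonClass α] (μ : Measure α) [IsProbabilityMeasure μ] :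
    ∑ a, μ.real {a} = 1 := by
  rw [sum_measureReal_singleton]
  simp

lemma sum_dataWeight {n d : ℕ} (D : Measure (Row d)) [IsProbabilityMeasure D] :
    ∑ x : Dataset n d, dataWeight D x = 1 := by
  simp_rw [← real_pi_singleton D]
  exact sum_real_singleton_eq_one _

lemma dataWeight_update_mul {n d : ℕ} (D : Measure (Row d)) (x : Dataset n d) (i : Fin n)
    (y : Row d) : dataWeight D (Function.update x i y) * D.real {x i} =
      dataWeight D x * D.real {y} := by
  unfold dataWeight
  rw [← Finset.mul_prod_erase _ _ (Finset.mem_univ i),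
    ← Finset.mul_prod_erase (a := i) _ (fun j => D.real {x j}) (Finset.mem_univ i)]
  have : ∏ j ∈ Finset.univ.erase i, D.real {Function.update x i y j} =
      ∏ j ∈ Finset.univ.erase i, D.real {x j} :=
    Finset.prod_congr rfl fun j hj => by
      rw [Function.update_of_ne (Finset.ne_of_mem_erase hj)]
  rw [this, Function.update_self]
  ring

/-- Exchanging a row with an independent sample does not change expectations. -/
lemma sum_swap_row {n d : ℕ} (D : Measure (Row d)) (i : Fin n) (g : Dataset n d → Row d → ℝ) :
    ∑ x, ∑ y, dataWeight D x * D.real {y} * g x y =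
      ∑ x, ∑ y, dataWeight D x * D.real {y} * g (Function.update x i y) (x i) := by
  -- The exchange is an involution preserving the weight of (x, y), so the identity is a change of
  -- variables.
  let s : Dataset n d × Row d → Dataset n d × Row d := fun z => (Function.update z.1 i z.2, z.1 i)
  have hs : Function.Involutive s := fun z => by simp [s]
  rw [← Fintype.sum_prod_type', ← Fintype.sum_prod_type', ← Equiv.sum_comp hs.toPerm]
  refine Finset.sum_congr rfl fun z _ => ?_
  simp only [Function.Involutive.coe_toPerm, s]
  rw [dataWeight_update_mul]

/-- The fresh sample may equal the old row, in which case the datasets are not neighbours; the bound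
then follows from e^ε ≥ 1 and δ ≥ 0. -/
lemma DiffPrivate.real_update_le {n d : ℕ} {U : Type*} [MeasurableSpace U] {ε δ : ℝ}
    {Q : Kernel (Dataset n d) U} (hε : 0 ≤ ε) (hδ : 0 ≤ δ)
    (hQ : DiffPrivate ε δ Q) (x : Dataset n d) (i : Fin n) (y : Row d) {S : Set U}
    (hS : MeasurableSet S) :
    (Q x).real S ≤ Real.exp ε * (Q (Function.update x i y)).real S + δ := by
  by_cases h : y = x i
  · subst h
    rw [Function.update_eq_self]
    nlinarith [Real.one_le_exp hε, measureReal_nonneg (μ := Q x) (s := S)]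
  · refine hQ _ _ ⟨i, by simpa using Ne.symm h, fun j hj => ?_⟩ S hS
    by_contra hne
    exact hj (by simp [Function.update_of_ne hne])

/-- Exchanging row `i` of the input of a private mechanism with an independent sample changes the
probability of an event by at most a factor `exp ε` and an additive `δ`. -/
lemma DiffPrivate.sum_swap_le {n d : ℕ} {ε δ : ℝ} {Q : Kernel (Dataset n d) (Pred d)}
    (hε : 0 ≤ ε) (hδ : 0 ≤ δ) (hQ : DiffPrivate ε δ Q) (D : Measure (Row d))
    [IsProbabilityMeasure D] (i : Fin n) (F : Dataset n d → Row d → Set (Pred d)) :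
    ∑ x, ∑ y, dataWeight D x * D.real {y} * (Q x).real (F x y) ≤
      Real.exp ε * (∑ x, ∑ y, dataWeight D x * D.real {y} *
        (Q x).real (F (Function.update x i y) (x i))) + δ := by
  have h1 : ∑ x, ∑ y, dataWeight D x * D.real {y} *
      (Q x).real (F (Function.update x i y) (x i)) =
      ∑ x, ∑ y, dataWeight D x * D.real {y} *
        (Q (Function.update x i y)).real (F x y) := by
    rw [sum_swap_row D i fun x y => (Q (Function.update x i y)).real (F x y)]
    simp
  have h2 : δ = ∑ x : Dataset n d, ∑ y, dataWeight D x * D.real {y} * δ := by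
    simp_rw [← Finset.sum_mul, ← Finset.mul_sum, ← Finset.sum_mul, sum_dataWeight,
      sum_real_singleton_eq_one]
    ring
  rw [h1]
  conv_rhs => rw [h2]
  simp_rw [Finset.mul_sum, ← Finset.sum_add_distrib]
  refine Finset.sum_le_sum fun x _ => Finset.sum_le_sum fun y _ => ?_
  have := mul_le_mul_of_nonneg_left
    (hQ.real_update_le hε hδ x i y (S := F x y) (Set.toFinite _).measurableSet)
    (mul_nonneg (dataWeight_nonneg D x) (measureReal_nonneg (μ := D) (s := {y})))
  linarith

/-! ### Averaging over an independent index; success probabilities as sums -/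

open scoped Classical in
-- Fubini for finite sums. It serves both for a fresh row weighted by D and, with c = 1, for
-- counting the rows that p matches or misses.
lemma sum_mul_real_sep {ι α : Type*} [Fintype ι] [Fintype α] [MeasurableSpace α]
    [MeasurableSingletonClass α] (μ : Measure α) [IsFiniteMeasure μ] (c : ι → ℝ) (G : Set α)
    (r : α → ι → Prop) :
    ∑ i, c i * μ.real {a | a ∈ G ∧ r a i} =
      ∑ a ∈ G.toFinset, μ.real {a} * ∑ i with r a i, c i := by
  have h : ∀ i, μ.real {a | a ∈ G ∧ r a i} =
      ∑ a ∈ G.toFinset, if r a i then μ.real {a} else 0 := by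
    intro i
    rw [← Finset.sum_filter, sum_measureReal_singleton]
    congr 1
    ext a
    simp
  simp_rw [h, Finset.mul_sum]
  rw [Finset.sum_comm]
  refine Finset.sum_congr rfl fun a _ => ?_
  rw [Finset.sum_filter]
  exact Finset.sum_congr rfl fun i _ => by split_ifs <;> ring

open scoped Classical in
lemma sum_mul_real_sep_le {ι α : Type*} [Fintype ι] [Fintype α] [MeasurableSpace α]
    [MeasurableSingletonClass α] (μ : Measure α) [IsFiniteMeasure μ] (c : ι → ℝ) (G : Set α)
    (r : α → ι → Prop) {w : ℝ} (h : ∀ a ∈ G, ∑ i with r a i, c i ≤ w) :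
    ∑ i, c i * μ.real {a | a ∈ G ∧ r a i} ≤ w * μ.real G := by
  rw [sum_mul_real_sep]
  have : μ.real G = ∑ a ∈ G.toFinset, μ.real {a} := by
    rw [sum_measureReal_singleton]; simp
  rw [this, mul_comm, Finset.sum_mul]
  exact Finset.sum_le_sum fun a ha =>
    mul_le_mul_of_nonneg_left (h a (by simpa using ha)) measureReal_nonneg

open scoped Classical in
lemma le_sum_mul_real_sep {ι α : Type*} [Fintype ι] [Fintype α] [MeasurableSpace α]
    [MeasurableSingletonClass α] (μ : Measure α) [IsFiniteMeasure μ] (c : ι → ℝ) (G : Set α)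
    (r : α → ι → Prop) {w : ℝ} (h : ∀ a ∈ G, w ≤ ∑ i with r a i, c i) :
    w * μ.real G ≤ ∑ i, c i * μ.real {a | a ∈ G ∧ r a i} := by
  rw [sum_mul_real_sep]
  have : μ.real G = ∑ a ∈ G.toFinset, μ.real {a} := by
    rw [sum_measureReal_singleton]; simp
  rw [this, mul_comm, Finset.sum_mul]
  exact Finset.sum_le_sum fun a ha =>
    mul_le_mul_of_nonneg_left (h a (by simpa using ha)) measureReal_nonneg

open scoped Classical in
lemma weight_eq_sum {d : ℕ} (D : Measure (Row d)) [IsFiniteMeasure D] (p : Pred d) :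
    weight D p = ∑ y with p y = true, D.real {y} := by
  rw [sum_measureReal_singleton, weight]
  congr 1
  ext y
  simp

lemma real_compProd_eq_sum {n d : ℕ} (D : Measure (Row d)) [IsProbabilityMeasure D]
    (Q : Kernel (Dataset n d) (Pred d)) [IsMarkovKernel Q] (S : Set (Dataset n d × Pred d)) :
    ((Measure.pi fun _ : Fin n => D) ⊗ₘ Q).real S =
      ∑ x, dataWeight D x * (Q x).real {p | (x, p) ∈ S} := by
  rw [measureReal_def, Measure.compProd_apply (Set.toFinite _).measurableSet, lintegral_fintype,
    ENNReal.toReal_sum (fun x _ => ENNReal.mul_ne_top (measure_ne_top _ _) (measure_ne_top _ _))]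
  refine Finset.sum_congr rfl fun x _ => ?_
  rw [ENNReal.toReal_mul, mul_comm, ← real_pi_singleton]
  rfl

lemma succProb_eq_sum {n d : ℕ} {T : Type*} [MeasurableSpace T] (D : Measure (Row d))
    [IsProbabilityMeasure D] (M : Kernel (Dataset n d) T) [IsMarkovKernel M]
    (A : Kernel T (Pred d)) [IsMarkovKernel A] (P : Set (Pred d)) :
    succProb D M A P =
      ∑ x, dataWeight D x * ((A ∘ₖ M) x).real {p | Isolates p x ∧ p ∈ P} :=
  real_compProd_eq_sum D (A ∘ₖ M) _

lemma succProb_nonneg {n d : ℕ} {T : Type*} [MeasurableSpace T] (D : Measure (Row d))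
    (M : Kernel (Dataset n d) T) (A : Kernel T (Pred d)) (P : Set (Pred d)) :
    0 ≤ succProb D M A P := measureReal_nonneg

lemma succProb_le_one {n d : ℕ} {T : Type*} [MeasurableSpace T] (D : Measure (Row d))
    [IsProbabilityMeasure D] (M : Kernel (Dataset n d) T) [IsMarkovKernel M]
    (A : Kernel T (Pred d)) [IsMarkovKernel A] (P : Set (Pred d)) :
    succProb D M A P ≤ 1 := measureReal_le_one

instance (n d : ℕ) : IsMarkovKernel (trivialMech n d) := by
  unfold trivialMech; infer_instance

lemma succProb_le_base {n d : ℕ} (D : Measure (Row d)) [IsProbabilityMeasure D]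
    (A : Kernel Unit (Pred d)) [hA : IsMarkovKernel A] (P : Set (Pred d)) :
    succProb D (trivialMech n d) A P ≤ base n D P := by
  refine le_ciSup (f := fun A : {A : Kernel Unit (Pred d) // IsMarkovKernel A} =>
    succProb D (trivialMech n d) A.1 P) ⟨1, ?_⟩ ⟨A, hA⟩
  rintro _ ⟨⟨B, hB⟩, rfl⟩
  exact succProb_le_one D _ B P

lemma base_nonneg {n d : ℕ} (D : Measure (Row d)) (P : Set (Pred d)) : 0 ≤ base n D P :=
  Real.iSup_nonneg fun A => succProb_nonneg D _ A.1 P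

/-! ### Isolation by fixed predicates and the baseline -/

/-- The probability that a fixed predicate isolates a row. -/
lemma real_pi_isolates {n d : ℕ} (D : Measure (Row d)) [IsProbabilityMeasure D] (p : Pred d) :
    (Measure.pi fun _ : Fin n => D).real {x | Isolates p x} =
      n * (weight D p * (1 - weight D p) ^ (n - 1)) := by
  -- The box of datasets where row i is the only match; these boxes partition the isolation event.
  let B : Fin n → Fin n → Set (Row d) := fun i j =>
    if j = i then {y | p y = true} else {y | p y = true}ᶜ
  have hmem : ∀ i (x : Dataset n d), x ∈ Set.univ.pi (B i) ↔ ∀ j, (p (x j) = true ↔ j = i) := by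
    intro i x
    simp only [Set.mem_univ_pi, B]
    refine forall_congr' fun j => ?_
    split_ifs with h <;> simp [h]
  have hset : {x : Dataset n d | Isolates p x} = ⋃ i, Set.univ.pi (B i) := by
    ext x
    simp only [Set.mem_ofPred_eq, Set.mem_iUnion, hmem, Isolates]
    constructor
    · rintro ⟨i, hi, h⟩
      exact ⟨i, fun j => ⟨h j, fun e => e ▸ hi⟩⟩
    · rintro ⟨i, h⟩
      exact ⟨i, (h i).2 rfl, fun j hj => (h j).1 hj⟩
  have hdisj : Pairwise (Function.onFun Disjoint fun i => Set.univ.pi (B i)) := by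
    intro i j hij
    refine Set.disjoint_left.2 fun x hi hj => hij ?_
    exact ((hmem j x).1 hj i).1 (((hmem i x).1 hi i).2 rfl)
  rw [hset, measureReal_iUnion_fintype hdisj fun i => (Set.toFinite _).measurableSet]
  have hterm : ∀ i, (Measure.pi fun _ : Fin n => D).real (Set.univ.pi (B i)) =
      weight D p * (1 - weight D p) ^ (n - 1) := by
    intro i
    rw [measureReal_def, Measure.pi_pi, ENNReal.toReal_prod,
      ← Finset.mul_prod_erase _ _ (Finset.mem_univ i)]
    congr 1
    · simp [B, weight, measureReal_def]
    · rw [Finset.prod_congr rfl (g := fun _ => 1 - weight D p), Finset.prod_const,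
        Finset.card_erase_of_mem (Finset.mem_univ i), Finset.card_univ, Fintype.card_fin]
      intro j hj
      have : B i j = {y | p y = true}ᶜ := if_neg (Finset.ne_of_mem_erase hj)
      rw [this, ← measureReal_def, probReal_compl_eq_one_sub (Set.toFinite _).measurableSet]
      rfl
  simp [hterm]

lemma le_base_of_mem {n d : ℕ} (D : Measure (Row d)) [IsProbabilityMeasure D]
    {P : Set (Pred d)} {p : Pred d} (hp : p ∈ P) :
    n * (weight D p * (1 - weight D p) ^ (n - 1)) ≤ base n D P := by
  refine le_trans (le_of_eq ?_)
    (succProb_le_base D (Kernel.const Unit (Measure.dirac p) : Kernel Unit (Pred d)) P)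
  rw [succProb_eq_sum, ← real_pi_isolates]
  have hterm : ∀ x : Dataset n d,
      (((Kernel.const Unit (Measure.dirac p) : Kernel Unit (Pred d)) ∘ₖ trivialMech n d) x).real
        {q | Isolates q x ∧ q ∈ P} = {x : Dataset n d | Isolates p x}.indicator 1 x := by
    intro x
    rw [measureReal_def, Kernel.comp_apply' _ _ _ (Set.toFinite _).measurableSet]
    by_cases h : Isolates p x <;> simp [trivialMech, h, hp]
  classical
  simp_rw [hterm, Set.indicator_apply, Pi.one_apply, mul_ite, mul_one, mul_zero,
    ← real_pi_singleton]
  rw [← Finset.sum_filter, sum_measureReal_singleton]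
  congr 1
  ext x
  simp

lemma weight_nonneg {d : ℕ} (D : Measure (Row d)) (p : Pred d) : 0 ≤ weight D p :=
  measureReal_nonneg

lemma weight_le_one {d : ℕ} (D : Measure (Row d)) [IsProbabilityMeasure D] (p : Pred d) :
    weight D p ≤ 1 := measureReal_le_one

/-! ### Low weights -/

/-- A private mechanism isolates with predicates of weight at most `w` with probability at most
`n (e^ε w + δ)`. -/
lemma DiffPrivate.succProb_le {n d : ℕ} {T : Type*} [MeasurableSpace T] {ε δ w : ℝ}
    {M : Kernel (Dataset n d) T} [IsMarkovKernel M] (hε : 0 ≤ ε) (hδ : 0 ≤ δ)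
    (hM : DiffPrivate ε δ M) (D : Measure (Row d)) [IsProbabilityMeasure D]
    (A : Kernel T (Pred d)) [IsMarkovKernel A] {P : Set (Pred d)} (hw0 : 0 ≤ w)
    (hw : ∀ p ∈ P, weight D p ≤ w) :
    succProb D M A P ≤ n * (Real.exp ε * w + δ) := by
  classical
  set Q := A ∘ₖ M
  have hQ : DiffPrivate ε δ Q := hM.comp A
  have hunion : ∀ x : Dataset n d, (Q x).real {p | Isolates p x ∧ p ∈ P} ≤
      ∑ i, (Q x).real {p | p ∈ P ∧ p (x i) = true} := by
    intro x
    refine le_trans (measureReal_mono ?_) (measureReal_iUnion_fintype_le _)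
    rintro p ⟨⟨i, hi, -⟩, hp⟩
    exact Set.mem_iUnion.2 ⟨i, hp, hi⟩
  have hrow : ∀ i : Fin n, ∑ x, dataWeight D x * (Q x).real {p | p ∈ P ∧ p (x i) = true} ≤
      Real.exp ε * w + δ := by
    intro i
    have h := hQ.sum_swap_le hε hδ D i fun x _ => {p | p ∈ P ∧ p (x i) = true}
    have hL : ∑ x, ∑ y, dataWeight D x * D.real {y} *
        (Q x).real {p | p ∈ P ∧ p (x i) = true} =
        ∑ x, dataWeight D x * (Q x).real {p | p ∈ P ∧ p (x i) = true} := by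
      refine Finset.sum_congr rfl fun x _ => ?_
      rw [← Finset.sum_mul, ← Finset.mul_sum, sum_real_singleton_eq_one, mul_one]
    have hR : ∑ x : Dataset n d, ∑ y, dataWeight D x * D.real {y} *
        (Q x).real {p | p ∈ P ∧ p (Function.update x i y i) = true} ≤ w := by
      calc _ ≤ ∑ x : Dataset n d, dataWeight D x * w := by
            refine Finset.sum_le_sum fun x _ => ?_
            simp_rw [mul_assoc, ← Finset.mul_sum, Function.update_self]
            refine mul_le_mul_of_nonneg_left ?_ (dataWeight_nonneg D x)
            refine (sum_mul_real_sep_le (Q x) (fun y => D.real {y}) P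
              (fun p y => p y = true) (w := w) fun p hp => ?_).trans ?_
            · have := hw p hp
              rw [weight_eq_sum] at this
              convert this
            · exact mul_le_of_le_one_right hw0 measureReal_le_one
        _ = w := by rw [← Finset.sum_mul, sum_dataWeight, one_mul]
    rw [hL] at h
    exact h.trans (by gcongr)
  rw [succProb_eq_sum]
  calc _ ≤ ∑ x, dataWeight D x * ∑ i, (Q x).real {p | p ∈ P ∧ p (x i) = true} :=
        Finset.sum_le_sum fun x _ =>
          mul_le_mul_of_nonneg_left (hunion x) (dataWeight_nonneg D x)
    _ = ∑ i, ∑ x, dataWeight D x * (Q x).real {p | p ∈ P ∧ p (x i) = true} := by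
        simp_rw [Finset.mul_sum]
        rw [Finset.sum_comm]
    _ ≤ ∑ _i : Fin n, (Real.exp ε * w + δ) := Finset.sum_le_sum fun i _ => hrow i
    _ = _ := by simp [mul_add]

/-- Security of private mechanisms for predicates of low weight. -/
lemma DiffPrivate.succProb_lowWeight_le {n d : ℕ} {T : Type*} [MeasurableSpace T] {ε δ w : ℝ}
    {M : Kernel (Dataset n d) T} [IsMarkovKernel M] (hn : 1 ≤ n) (hε : 0 ≤ ε) (hδ : 0 ≤ δ)
    (hM : DiffPrivate ε δ M) (hw : w ≤ 1 / (n : ℝ)) (D : Measure (Row d))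
    [IsProbabilityMeasure D] (A : Kernel T (Pred d)) [IsMarkovKernel A] :
    succProb D M A (lowWeight D w) ≤
      Real.exp (ε + ((n : ℝ) - 1) * Real.log (1 / (1 - w))) * base n D (lowWeight D w) +
        n * δ := by
  set P := lowWeight D w with hP
  have hrhs : 0 ≤ Real.exp (ε + ((n : ℝ) - 1) * Real.log (1 / (1 - w))) * base n D P :=
    mul_nonneg (Real.exp_pos _).le (base_nonneg D P)
  rcases P.eq_empty_or_nonempty with he | hne
  · have : succProb D M A P = 0 := by
      rw [succProb_eq_sum, he]
      simp
    rw [this]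
    positivity
  -- The largest weight attained replaces w: no predicate need have weight exactly w, and the
  -- baseline is bounded below only by actual predicates.
  obtain ⟨p, hp, hmax⟩ := Set.exists_max_image P (weight D) (Set.toFinite P) hne
  have h1 := hM.succProb_le hε hδ D A (weight_nonneg D p) hmax
  have h2 := le_base_of_mem (n := n) D hp
  have hpw : weight D p ≤ w := hp
  have hp0 := weight_nonneg D p
  have h3 : n * weight D p ≤
      Real.exp (((n : ℝ) - 1) * Real.log (1 / (1 - w))) * base n D P := by
    -- For n = 1, w may equal 1 but the exponent vanishes; for n ≥ 2, w ≤ 1/n keeps 1 - w positive.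
    obtain rfl | hn2 : n = 1 ∨ 2 ≤ n := by omega
    · simpa using h2
    have hn2' : (2 : ℝ) ≤ n := by exact_mod_cast hn2
    have hw1 : w < 1 := hw.trans_lt (by rw [div_lt_one] <;> linarith)
    have hexp : Real.exp (((n : ℝ) - 1) * Real.log (1 / (1 - w))) = (1 / (1 - w)) ^ (n - 1) := by
      rw [← Nat.cast_pred hn, mul_comm, Real.exp_mul, Real.exp_log (by
        have : 0 < 1 - w := by linarith
        positivity), Real.rpow_natCast]
    have hpos : 0 < 1 - w := by linarith
    calc n * weight D p = (1 / (1 - w)) ^ (n - 1) *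
          (n * (weight D p * (1 - w) ^ (n - 1))) := by
          rw [one_div, inv_pow]
          field_simp
      _ ≤ (1 / (1 - w)) ^ (n - 1) * (n * (weight D p * (1 - weight D p) ^ (n - 1))) := by
          gcongr
      _ ≤ _ := by
          rw [hexp]
          gcongr
  calc succProb D M A P ≤ n * (Real.exp ε * weight D p + δ) := h1
    _ = Real.exp ε * (n * weight D p) + n * δ := by ring
    _ ≤ Real.exp ε * (Real.exp (((n : ℝ) - 1) * Real.log (1 / (1 - w))) * base n D P) +
        n * δ := by gcongr
    _ = _ := by rw [Real.exp_add, mul_assoc]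

/-! ### High weights -/

/-- The probability that the predicate lies in `P` and is satisfied by exactly `k` rows. -/
def matchProb {n d : ℕ} (D : Measure (Row d)) (Q : Kernel (Dataset n d) (Pred d))
    (P : Set (Pred d)) (k : ℕ) : ℝ :=
  ∑ x, dataWeight D x * (Q x).real {p | p ∈ P ∧ matchCount p x = k}

lemma matchProb_nonneg {n d : ℕ} (D : Measure (Row d)) (Q : Kernel (Dataset n d) (Pred d))
    (P : Set (Pred d)) (k : ℕ) : 0 ≤ matchProb D Q P k :=
  Finset.sum_nonneg fun x _ => mul_nonneg (dataWeight_nonneg D x) measureReal_nonneg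

lemma matchProb_le_one {n d : ℕ} (D : Measure (Row d)) [IsProbabilityMeasure D]
    (Q : Kernel (Dataset n d) (Pred d)) [IsMarkovKernel Q] (P : Set (Pred d)) (k : ℕ) :
    matchProb D Q P k ≤ 1 := by
  rw [← sum_dataWeight (n := n) D]
  exact Finset.sum_le_sum fun x _ =>
    mul_le_of_le_one_right (dataWeight_nonneg D x) measureReal_le_one

lemma matchCount_update_succ {n d : ℕ} (p : Pred d) (x : Dataset n d) (i : Fin n) (y : Row d)
    (hx : p (x i) = true) (hy : p y = false) :
    matchCount p (Function.update x i y) + 1 = matchCount p x := by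
  unfold matchCount
  have : (Finset.univ.filter fun j => p (Function.update x i y j) = true) =
      (Finset.univ.filter fun j => p (x j) = true).erase i := by
    ext j
    by_cases h : j = i
    · subst h; simp [hy]
    · simp [h]
  rw [this]
  exact Finset.card_erase_add_one (by simp [hx])

/-- Differential privacy relates the probabilities of `k` and of `k + 1` satisfied rows. -/
lemma DiffPrivate.matchProb_le_succ {n d : ℕ} {ε δ w : ℝ} {Q : Kernel (Dataset n d) (Pred d)}
    [IsMarkovKernel Q] (hε : 0 ≤ ε) (hδ : 0 ≤ δ) (hw : 0 ≤ w)
    (hQ : DiffPrivate ε δ Q) (D : Measure (Row d)) [IsProbabilityMeasure D] {P : Set (Pred d)}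
    (hP : ∀ p ∈ P, w ≤ weight D p) (k : ℕ) :
    w * (n - k) * matchProb D Q P k ≤
      Real.exp ε * ((k + 1) * matchProb D Q P (k + 1)) + n * δ := by
  classical
  let G : ℕ → Dataset n d → Set (Pred d) := fun k x => {p | p ∈ P ∧ matchCount p x = k}
  let L : Fin n → ℝ := fun i => ∑ x, dataWeight D x *
    (Q x).real {p | p ∈ G k x ∧ ¬ p (x i) = true}
  let R : Fin n → ℝ := fun i => ∑ x, dataWeight D x *
    (Q x).real {p | p ∈ G (k + 1) x ∧ p (x i) = true}
  have hrow : ∀ i, w * L i ≤ Real.exp ε * R i + δ := by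
    intro i
    -- The event: p matches k rows, misses row i and matches the fresh y. After the exchange the row
    -- seen by Q is the matched one, so its dataset has k + 1 matches.
    have h := hQ.sum_swap_le hε hδ D i fun x y =>
      {p | p ∈ {p | p ∈ G k x ∧ ¬ p (x i) = true} ∧ p y = true}
    have hleft : w * L i ≤ ∑ x, ∑ y, dataWeight D x * D.real {y} *
        (Q x).real {p | p ∈ {p | p ∈ G k x ∧ ¬ p (x i) = true} ∧ p y = true} := by
      rw [Finset.mul_sum]
      refine Finset.sum_le_sum fun x _ => ?_
      simp_rw [mul_assoc, ← Finset.mul_sum]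
      rw [mul_left_comm]
      refine mul_le_mul_of_nonneg_left ?_ (dataWeight_nonneg D x)
      exact le_sum_mul_real_sep (Q x) (fun y => D.real {y}) _ (fun p y => p y = true)
        fun p hp => by
          have := hP p hp.1.1
          rw [weight_eq_sum] at this
          convert this
    have hright : ∑ x : Dataset n d, ∑ y, dataWeight D x * D.real {y} *
        (Q x).real {p | p ∈ {p | p ∈ G k (Function.update x i y) ∧
          ¬ p (Function.update x i y i) = true} ∧ p (x i) = true} ≤ R i := by
      refine Finset.sum_le_sum fun x _ => ?_
      calc _ ≤ ∑ y, dataWeight D x * D.real {y} *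
            (Q x).real {p | p ∈ G (k + 1) x ∧ p (x i) = true} := by
            refine Finset.sum_le_sum fun y _ => mul_le_mul_of_nonneg_left
              (measureReal_mono ?_) (mul_nonneg (dataWeight_nonneg D x) measureReal_nonneg)
            rintro p ⟨⟨⟨hpP, hpk⟩, hpy⟩, hpx⟩
            rw [Function.update_self, Bool.not_eq_true] at hpy
            exact ⟨⟨hpP, by rw [← matchCount_update_succ p x i y hpx hpy, hpk]⟩, hpx⟩
        _ = _ := by
            rw [← Finset.sum_mul, ← Finset.mul_sum, sum_real_singleton_eq_one, mul_one]
    exact hleft.trans (h.trans (by gcongr))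
  -- Double counting: k matches leave n - k rows to serve as i here, and k + 1 matches offer k + 1
  -- choices in `hRsum`.
  have hLsum : ((n : ℝ) - k) * matchProb D Q P k ≤ ∑ i, L i := by
    rw [matchProb, Finset.mul_sum]
    simp only [L]
    rw [Finset.sum_comm]
    refine Finset.sum_le_sum fun x _ => ?_
    rw [← Finset.mul_sum, mul_left_comm]
    refine mul_le_mul_of_nonneg_left ?_ (dataWeight_nonneg D x)
    have := le_sum_mul_real_sep (Q x) (fun _ : Fin n => (1 : ℝ)) (G k x)
      (fun p i => ¬ p (x i) = true) (w := (n : ℝ) - k) fun p hp => by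
        have hc := Finset.card_filter_add_card_filter_not (s := (Finset.univ : Finset (Fin n)))
          (fun i => p (x i) = true)
        have hk : (Finset.univ.filter fun i => p (x i) = true).card = k := hp.2
        rw [hk, Finset.card_univ, Fintype.card_fin] at hc
        rw [Finset.sum_const, nsmul_eq_mul, mul_one]
        have hc' : (n : ℝ) ≤ k + ((Finset.univ.filter fun i => ¬ p (x i) = true).card : ℝ) := by
          exact_mod_cast hc.ge
        refine (sub_le_iff_le_add'.2 hc').trans (le_of_eq ?_)
        congr!
    simpa only [one_mul] using this
  have hRsum : ∑ i, R i ≤ (k + 1) * matchProb D Q P (k + 1) := by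
    rw [matchProb, Finset.mul_sum]
    simp only [R]
    rw [Finset.sum_comm]
    refine Finset.sum_le_sum fun x _ => ?_
    rw [← Finset.mul_sum, mul_left_comm]
    refine mul_le_mul_of_nonneg_left ?_ (dataWeight_nonneg D x)
    have := sum_mul_real_sep_le (Q x) (fun _ : Fin n => (1 : ℝ)) (G (k + 1) x)
      (fun p i => p (x i) = true) (w := (k : ℝ) + 1) fun p hp => by
        have hk : (Finset.univ.filter fun i => p (x i) = true).card = k + 1 := hp.2
        rw [Finset.sum_const, nsmul_eq_mul, mul_one]
        refine le_of_eq ?_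
        rw [← Nat.cast_succ, Nat.cast_inj]
        convert hk
    simpa only [one_mul] using this
  calc w * (n - k) * matchProb D Q P k = w * ((n - k) * matchProb D Q P k) := by ring
    _ ≤ w * ∑ i, L i := by gcongr
    _ = ∑ i, w * L i := Finset.mul_sum ..
    _ ≤ ∑ i, (Real.exp ε * R i + δ) := Finset.sum_le_sum fun i _ => hrow i
    _ = Real.exp ε * ∑ i, R i + n * δ := by
        rw [Finset.sum_add_distrib, ← Finset.mul_sum]; simp
    _ ≤ _ := by gcongr

/-- Unrolling the recursion K - 1 times, the errors form a geometric series of sum at most 2η. -/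
lemma le_half_pow_add_of_le_half_succ_add {a : ℕ → ℝ} {η : ℝ} (hη : 0 ≤ η) {K : ℕ}
    (h1 : ∀ k, a k ≤ 1) (h : ∀ k, 1 ≤ k → k < K → a k ≤ a (k + 1) / 2 + η) :
    a 1 ≤ (1 / 2) ^ (K - 1) + 2 * η := by
  have key : ∀ j, j ≤ K - 1 → a 1 ≤ (1 / 2) ^ j * a (j + 1) + 2 * η * (1 - (1 / 2) ^ j) := by
    intro j
    induction j with
    | zero => simp
    | succ j ih =>
      intro hj
      have h2 := mul_le_mul_of_nonneg_left (h (j + 1) (by omega) (by omega))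
        (by positivity : (0 : ℝ) ≤ (1 / 2) ^ j)
      have h3 := ih (by omega)
      rw [pow_succ]
      linarith
  have hpos : (0 : ℝ) ≤ (1 / 2) ^ (K - 1) := by positivity
  have h2 := mul_le_mul_of_nonneg_left (h1 (K - 1 + 1)) hpos
  have h3 := mul_nonneg hη hpos
  linarith [key (K - 1) le_rfl]

/-- A private mechanism does not isolate with predicates of high weight. -/
lemma DiffPrivate.succProb_highWeight_le {n d : ℕ} {T : Type*} [MeasurableSpace T]
    {ε δ w : ℝ} {M : Kernel (Dataset n d) T} [IsMarkovKernel M] (hn : 1 ≤ n) (hε : 0 ≤ ε)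
    (hδ : 0 ≤ δ) (hM : DiffPrivate ε δ M) (hw : 0 < w) {K : ℕ}
    (hK : 4 * Real.exp ε * K ≤ w * n) (D : Measure (Row d))
    [IsProbabilityMeasure D] (A : Kernel T (Pred d)) [IsMarkovKernel A] :
    succProb D M A (highWeight D w) ≤ (1 / 2) ^ (K - 1) + 4 * (δ / w) := by
  rw [succProb_eq_sum]
  rcases (highWeight D w).eq_empty_or_nonempty with he | ⟨p, hp⟩
  · rw [he]
    simp only [Set.mem_empty_iff_false, and_false, Set.ofPred_false, measureReal_empty, mul_zero,
      Finset.sum_const_zero]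
    positivity
  have hw1 : w ≤ 1 := le_trans hp (weight_le_one D p)
  have heq : ∑ x, dataWeight D x *
      ((A ∘ₖ M) x).real {p | Isolates p x ∧ p ∈ highWeight D w} =
      matchProb D (A ∘ₖ M) (highWeight D w) 1 := by
    simp_rw [isolates_iff_matchCount, and_comm (a := matchCount _ _ = 1)]
    rfl
  rw [heq]
  have hn0 : (0 : ℝ) < n := by exact_mod_cast hn
  have hKn : 4 * (K : ℝ) ≤ n := by
    have h1 : (K : ℝ) ≤ Real.exp ε * K :=
      le_mul_of_one_le_left (Nat.cast_nonneg _) (Real.one_le_exp hε)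
    have h2 : w * n ≤ n := mul_le_of_le_one_left hn0.le hw1
    linarith
  -- For k < K, n - k ≥ n/2 and e^ε (k + 1) ≤ wn/4. Dividing by wn/2 gives the factor 1/2 and the
  -- error 2δ/w.
  refine (le_half_pow_add_of_le_half_succ_add (K := K) (η := 2 * (δ / w)) (by positivity)
    (matchProb_le_one D (A ∘ₖ M) (highWeight D w)) fun k _ hkK => ?_).trans (by linarith)
  have h := (hM.comp A).matchProb_le_succ hε hδ hw.le D (P := highWeight D w)
    (fun p hp => hp) k
  have h0 := matchProb_nonneg D (A ∘ₖ M) (highWeight D w) k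
  have h1 := matchProb_nonneg D (A ∘ₖ M) (highWeight D w) (k + 1)
  set a := matchProb D (A ∘ₖ M) (highWeight D w) k
  set b := matchProb D (A ∘ₖ M) (highWeight D w) (k + 1)
  have hkK' : (k : ℝ) + 1 ≤ K := by exact_mod_cast hkK
  have hk0 : (0 : ℝ) ≤ k := Nat.cast_nonneg k
  have hleft : w * (n / 2) * a ≤ w * (n - k) * a := by
    gcongr
    linarith
  have hright : Real.exp ε * ((k + 1) * b) ≤ w * n / 4 * b := by
    rw [← mul_assoc]
    refine mul_le_mul_of_nonneg_right ?_ h1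
    have := mul_le_mul_of_nonneg_left hkK' (Real.exp_pos ε).le
    linarith
  have hfin : w * n / 2 * a ≤ w * n / 2 * (b / 2 + 2 * (δ / w)) := by
    have : w * n / 2 * (b / 2 + 2 * (δ / w)) = w * n / 4 * b + n * δ := by
      field_simp
      ring
    linarith
  exact le_of_mul_le_mul_left hfin (by positivity)

/-! ### Negligibility -/

lemma half_pow_floor_sub_one_le (t : ℝ) :
    (1 / 2 : ℝ) ^ (⌊t⌋₊ - 1) ≤ 4 * Real.exp (-(t * Real.log 2)) := by
  -- The floor and the truncated subtraction each lose at most 1, whence the factor 4 = 2^2.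
  have h1 : t - 2 ≤ ((⌊t⌋₊ - 1 : ℕ) : ℝ) := by
    have := Nat.lt_floor_add_one t
    have h2 : ((⌊t⌋₊ : ℕ) : ℝ) ≤ ((⌊t⌋₊ - 1 : ℕ) : ℝ) + 1 := by
      exact_mod_cast (by omega : ⌊t⌋₊ ≤ ⌊t⌋₊ - 1 + 1)
    linarith
  have h4 : (4 : ℝ) = Real.exp (2 * Real.log 2) := by
    rw [mul_comm, Real.exp_mul, Real.exp_log two_pos]
    norm_num
  have h2 : (1 / 2 : ℝ) ^ (⌊t⌋₊ - 1) = Real.exp (-(((⌊t⌋₊ - 1 : ℕ) : ℝ) * Real.log 2)) := by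
    rw [← neg_mul, mul_comm, Real.exp_mul, Real.exp_log two_pos, Real.rpow_neg two_pos.le,
      Real.rpow_natCast, one_div, inv_pow]
  rw [h2, h4, ← Real.exp_add, Real.exp_le_exp]
  nlinarith [Real.log_pos one_lt_two]

lemma eventually_mul_log_le {w : ℕ → ℝ}
    (hw : Tendsto (fun n : ℕ => w n / (Real.log n / n)) atTop atTop) (B : ℝ) :
    ∀ᶠ n : ℕ in atTop, B * Real.log n ≤ w n * n := by
  filter_upwards [hw.eventually_ge_atTop B, eventually_ge_atTop 2] with n hn h2
  have hlog : 0 < Real.log n := Real.log_pos (by exact_mod_cast h2)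
  have hn0 : (0 : ℝ) < n := by exact_mod_cast (by omega : 0 < n)
  rwa [div_div_eq_mul_div, le_div_iff₀ hlog] at hn

lemma negligible_half_pow_floor {w : ℕ → ℝ} {E : ℝ} (hE : 0 < E)
    (hw : Tendsto (fun n : ℕ => w n / (Real.log n / n)) atTop atTop) :
    Negligible fun n => (1 / 2 : ℝ) ^ (⌊w n * n / E⌋₊ - 1) := by
  intro m
  have hlog2 : 0 < Real.log 2 := Real.log_pos one_lt_two
  refine squeeze_zero' (Eventually.of_forall fun n => by positivity) ?_
    (tendsto_const_div_atTop_nhds_zero_nat 4)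
  -- This multiple of log n makes 2^(-wn/E) at most n^(-(m+1)), one power more than needed.
  filter_upwards [eventually_mul_log_le hw (E * (m + 1) / Real.log 2), eventually_ge_atTop 1]
    with n hn h1
  have hn0 : (0 : ℝ) < n := by exact_mod_cast h1
  have hexp : Real.exp (-(w n * n / E * Real.log 2)) ≤ ((n : ℝ) ^ (m + 1))⁻¹ := by
    rw [← Real.exp_log (pow_pos hn0 (m + 1)), ← Real.exp_neg, Real.exp_le_exp, Real.log_pow,
      neg_le_neg_iff, div_mul_eq_mul_div, le_div_iff₀ hE]
    rw [div_mul_eq_mul_div, div_le_iff₀ hlog2] at hn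
    push_cast
    linarith
  calc (n : ℝ) ^ m * (1 / 2 : ℝ) ^ (⌊w n * n / E⌋₊ - 1)
      ≤ (n : ℝ) ^ m * (4 * ((n : ℝ) ^ (m + 1))⁻¹) := by
        gcongr
        exact (half_pow_floor_sub_one_le _).trans (by gcongr)
    _ = 4 / n := by
        rw [pow_succ]
        field_simp

end PSO

/-! ### Assembly -/

theorem mainTheorem1 (d : ℕ → ℕ) (T : ℕ → Type*) [∀ n, MeasurableSpace (T n)]
    (ε δ wlow whigh : ℕ → ℝ)
    (hε_nonneg : ∀ n, 1 ≤ n → 0 ≤ ε n)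
    (hε : ε =O[atTop] (fun _ => (1 : ℝ)))
    (hδ_nonneg : ∀ n, 1 ≤ n → 0 ≤ δ n)
    (hδ : PSO.Negligible δ)
    (hwlow : ∀ n : ℕ, 1 ≤ n → wlow n ≤ 1 / (n : ℝ))
    (hwhigh : Tendsto (fun n : ℕ => whigh n / (Real.log n / n)) atTop atTop)
    (M : ∀ n, Kernel (PSO.Dataset n (d n)) (T n)) [∀ n, IsMarkovKernel (M n)]
    (hM : ∀ n, 1 ≤ n → PSO.DiffPrivate (ε n) (δ n) (M n)) :
    ∃ δ' : ℕ → ℝ, (∀ n, 0 ≤ δ' n) ∧ PSO.Negligible δ' ∧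
      PSO.PSOSecure
        (fun n => ε n + ((n : ℝ) - 1) * Real.log (1 / (1 - wlow n))) δ' wlow whigh M := by
  obtain ⟨c, hc⟩ := hε.bound
  have hlarge : ∀ᶠ n : ℕ in atTop, ε n ≤ c ∧ 1 ≤ whigh n * n ∧ 1 ≤ n := by
    filter_upwards [hc, PSO.eventually_mul_log_le hwhigh 1, eventually_ge_atTop 1,
      (Real.tendsto_log_atTop.comp tendsto_natCast_atTop_atTop).eventually_ge_atTop 1]
      with n h1 h2 h3 h4
    have h4' : 1 ≤ Real.log n := h4
    refine ⟨?_, by linarith, h3⟩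
    rw [norm_one, mul_one] at h1
    exact (le_abs_self _).trans h1
  obtain ⟨N, hN⟩ := eventually_atTop.1 hlarge
  let E : ℝ := 4 * Real.exp c
  have hE : 0 < E := by positivity
  let η : ℕ → ℝ := fun n => (1 / 2 : ℝ) ^ (⌊whigh n * n / E⌋₊ - 1) + 4 * (n * δ n)
  -- Below N the bounds on ε and `whigh` may fail; the value 1 makes security trivial there without
  -- affecting negligibility.
  let δ' : ℕ → ℝ := fun n => if n < N then 1 else η n
  have hη : PSO.Negligible η :=
    (PSO.negligible_half_pow_floor hE hwhigh).add (hδ.param_mul.const_mul 4)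
  refine ⟨δ', fun n => ?_, ?_, ?_⟩
  · by_cases h : n < N
    · simp [δ', h]
    · have := hδ_nonneg n (hN n (not_lt.1 h)).2.2
      simp only [δ', h, if_false, η]
      positivity
  · refine hη.congr' ?_
    filter_upwards [eventually_ge_atTop N] with n hn
    simp [δ', not_lt.2 hn]
  · intro n hn D hD A hA
    have hδn := hδ_nonneg n hn
    have hnonneg : ∀ P, 0 ≤ Real.exp (ε n + ((n : ℝ) - 1) * Real.log (1 / (1 - wlow n))) *
        PSO.base n D P := fun P => mul_nonneg (Real.exp_pos _).le (PSO.base_nonneg D P)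
    by_cases h : n < N
    · have hδ' : δ' n = 1 := if_pos h
      simp only [hδ']
      exact ⟨(PSO.succProb_le_one D (M n) A _).trans (le_add_of_nonneg_left (hnonneg _)),
        (PSO.succProb_le_one D (M n) A _).trans (le_add_of_nonneg_left (hnonneg _))⟩
    obtain ⟨hεc, hw1, -⟩ := hN n (not_lt.1 h)
    have hδ' : δ' n = η n := if_neg h
    have hn0 : (0 : ℝ) < n := by exact_mod_cast hn
    have hw : 0 < whigh n := pos_of_mul_pos_left (one_pos.trans_le hw1) hn0.le
    simp only [hδ']
    constructor
    · refine ((hM n hn).succProb_lowWeight_le hn (hε_nonneg n hn) hδn (hwlow n hn) D A).trans ?_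
      have h1 : (0 : ℝ) ≤ (1 / 2 : ℝ) ^ (⌊whigh n * n / E⌋₊ - 1) := by positivity
      have h2 : 0 ≤ n * δ n := by positivity
      simp only [η]
      linarith
    · have hK : 4 * Real.exp (ε n) * ⌊whigh n * n / E⌋₊ ≤ whigh n * n := by
        calc 4 * Real.exp (ε n) * ⌊whigh n * n / E⌋₊ ≤ E * (whigh n * n / E) := by
              gcongr
              · exact mul_le_mul_of_nonneg_left (Real.exp_le_exp.2 hεc) (by norm_num)
              · exact Nat.floor_le (by positivity)
          _ = whigh n * n := by field_simp
      -- Since n * `whigh n` ≥ 1, the error δ/w stays negligible.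
      have hδw : δ n / whigh n ≤ n * δ n := by
        rw [div_le_iff₀ hw]
        nlinarith
      have hsucc := (hM n hn).succProb_highWeight_le hn (hε_nonneg n hn) hδn hw hK D A
      have := hnonneg (PSO.highWeight D (whigh n))
      simp only [η]
      linarith
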